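/- There are absolute constants $C, c, \delta_0 > 0$ such that the following holds for every $B>1$, every dimension $d \ge 2$, every horizon $H \ge 2$ and every accuracy $0<\varepsilon\le c\,\min\{1,B-1\}$. For a positive integer $K'$ and a sign vector $\sigma\in\{-1,1\}^{d-1}$ consider the episodic time-homogeneous MDP with states $\{x_1,x_2,x_3\}$, initial state $x_1$, actions $\mathbf a\in\{-1,1\}^{d-1}$, absorbing states $x_2,x_3$, and $$\mathbb P(x_3\mid x_1,\mathbf a)=\tfrac16+\langle\boldsymbol\mu,\mathbf a\rangle,\qquad \mathbb P(x_2\mid x_1,\mathbf a)=1-\tfrac16-\langle\boldsymbol\mu,\mathbf a\rangle,\qquad \boldsymbol\mu=\Delta\sigma,\quad \Delta=\frac{\sqrt{1/(6K')}}{4\sqrt2},$$ written as $\mathbb P(s'\mid s,\mathbf a)=\langle\boldsymbol\phi(s'\mid s,\mathbf a),\boldsymbol\theta\rangle$ with the parameter $\boldsymbol\theta=(1/\alpha,\boldsymbol\mu^\top/\beta)^\top\in\mathbb R^d$ and the features $\boldsymbol\phi(x_2\mid x_1,\mathbf a)=(\tfrac56\alpha,-\beta\mathbf a^\top)^\top$,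 $\boldsymbol\phi(x_3\mid x_1,\mathbf a)=(\tfrac16\alpha,\beta\mathbf a^\top)^\top$, $\boldsymbol\phi(x_i\mid x_i,\mathbf a)=(\alpha,\mathbf 0^\top)^\top$ for $i=2,3$, and $\boldsymbol\phi=\mathbf 0$ otherwise, where $\alpha=\sqrt{1/(1+(d-1)\Delta)}$ and $\beta=\sqrt{\Delta/(1+(d-1)\Delta)}$. The reward is $r_h(x_1,\cdot)=r_h(x_2,\cdot)=0$ and $r_h(x_3,\cdot)=1/H$ for all $h\in[H]$. There is a $K'$ (and thus a feature map $\boldsymbol\phi$, which may be known to the algorithm) such that for every $0<\delta\le\delta_0$, every $K$ and every (possibly randomized) reward-free algorithm that collects $K$ episodes in its exploration phase, with $$K<\frac{C\,d^2}{\varepsilon^2},$$ there is a sign vector $\sigma$ for which the above is a linear mixture MDP with $\|\boldsymbol\theta\|_2\le B$ and $\|\sum_{s'}\boldsymbol\phi(s'\mid s,\mathbf a)V(s')\|_2\le1$ for all $V:\mathcal S\to[0,1]$ and all $(s,\mathbf a)$, the rewards are in $[0,1]$ with $0\le\sum_{h=1}^H r_h(s_h,a_h)\le1$ along every trajectory,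 and the policy $\pi$ returned by the algorithm in the planning phase for the reward $r$ satisfies $V_1^*(x_1;r)-V_1^\pi(x_1;r)\le\varepsilon$ with probability less than $1-\delta$. In other words, $\Omega(d^2\varepsilon^{-2})$ episodes are needed to output an $\varepsilon$-optimal policy with probability at least $1-\delta$. Here a reward-free algorithm acts, in its exploration phase, on the basis of the observed states and actions only (all the earlier episodes and the current one, each episode including the final state $s_{H+1}$); it is given $r$ only in the planning phase and then returns a deterministic nonstationary Markov policy, possibly chosen at random. -/

import Mathlib

namespace RewardFreeRL

noncomputable section

/-! ### Episodic time-homogeneous MDPs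

Stages are indexed by `Fin H`, so that stage `0` is the first one. -/

/-- A time-homogeneous transition kernel `ℙ(· | s, a)`. -/
abbrev TransitionKernel (S A : Type*) := S → A → PMF S

/-- A deterministic reward function `r = {r_h}`. -/
abbrev Reward (S A : Type*) (H : ℕ) := Fin H → S → A → ℝ

/-- A (deterministic, nonstationary, Markov) policy `π = {π_h}`. -/
abbrev Policy (S A : Type*) (H : ℕ) := Fin H → S → A

/-- The state-action pairs of the first `h` stages of an episode. -/
abbrev History (S A : Type*) (h : ℕ) := Fin h → S × A

/-- A complete episode: all `H` state-action pairs and the final state `s_{H+1}`. -/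
abbrev Episode (S A : Type*) (H : ℕ) := History S A H × S

/-- A rule for acting within one episode: at each stage a (random) action is drawn on the basis of
the stages already seen in the episode and the current state. -/
abbrev ActingRule (S A : Type*) (H : ℕ) := (h : Fin H) → History S A h → S → PMF A

variable {S A : Type*} {H K d : ℕ}

/-- The acting rule that follows a policy. -/
def Policy.toActingRule (π : Policy S A H) : ActingRule S A H :=
  fun h _ s => PMF.pure (π h s)

/-- Joint law of the first `h` state-action pairs and of the next state, when the episode starts in
`s₁` and actions are chosen by `ρ`. -/
def historyLaw (P : TransitionKernel S A) (s₁ : S) (ρ : ActingRule S A H) :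
    (h : ℕ) → h ≤ H → PMF (History S A h × S)
  | 0, _ => PMF.pure (Fin.elim0, s₁)
  | h + 1, hh =>
      (historyLaw P s₁ ρ h (Nat.le_of_succ_le hh)).bind fun x =>
        (ρ ⟨h, hh⟩ x.1 x.2).bind fun a =>
          (P x.2 a).map fun s' => (Fin.snoc (α := fun _ => S × A) x.1 (x.2, a), s')

/-- Law of a complete episode. -/
def episodeLaw (P : TransitionKernel S A) (s₁ : S) (ρ : ActingRule S A H) : PMF (Episode S A H) :=
  historyLaw P s₁ ρ H le_rfl

/-- Accumulated reward `∑ₕ r_h(s_h, a_h)`. -/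
def totalReward (r : Reward S A H) (τ : History S A H) : ℝ :=
  ∑ h : Fin H, r h (τ h).1 (τ h).2

/-- The value `V_1^π(s₁; r)`: the expected accumulated reward of `π`. -/
def value (P : TransitionKernel S A) (s₁ : S) (r : Reward S A H) (π : Policy S A H) : ℝ :=
  ∑' e : Episode S A H, (episodeLaw P s₁ π.toActingRule e).toReal * totalReward r e.1

/-- The optimal value `V_1^*(s₁; r)`. -/
def optimalValue (P : TransitionKernel S A) (s₁ : S) (r : Reward S A H) : ℝ :=
  ⨆ π : Policy S A H, value P s₁ r π

/-- The class `𝓡` of rewards with values in `[0, 1]` and accumulated reward in `[0, 1]` along every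
trajectory. -/
def boundedTotalRewards (S A : Type*) (H : ℕ) : Set (Reward S A H) :=
  {r | (∀ h s a, r h s a ∈ Set.Icc (0 : ℝ) 1) ∧
    ∀ τ : History S A H, totalReward r τ ∈ Set.Icc (0 : ℝ) 1}

/-! ### Linear mixture MDPs -/

/-- `P` is the kernel of a `B`-bounded linear mixture MDP with known features
`φ s a s' = φ(s' | s, a) ∈ ℝᵈ` (`d` signed basis measures for each `s, a`) and parameter `θ`. -/
structure IsLinearMixture (φ : S → A → S → EuclideanSpace ℝ (Fin d))
    (θ : EuclideanSpace ℝ (Fin d)) (B : ℝ) (P : TransitionKernel S A) : Prop where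
  prob_eq : ∀ s a s', (P s a s').toReal = ∑ i, φ s a s' i * θ i
  summable : ∀ s a, Summable fun s' => φ s a s'
  norm_param_le : ‖θ‖ ≤ B
  norm_feature_le : ∀ V : S → ℝ, (∀ s, V s ∈ Set.Icc (0 : ℝ) 1) →
    ∀ s a, ‖∑' s', V s' • φ s a s'‖ ≤ 1

/-! ### Reward-free algorithms -/

/-- A (possibly randomized) reward-free algorithm that collects `K` episodes. In the exploration
phase it interacts with the environment without seeing a reward: in each episode it acts on the
basis of all the earlier episodes and of the current one. In the planning phase it is given a
reward and returns a (possibly random) policy on the basis of the collected episodes.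
All actions are recorded in the episodes, so drawing fresh randomness at each decision loses no
generality. Everything that is known in advance (features, bounds, accuracy, initial state) may be
built into `explore` and `plan`. -/
structure Algorithm (S A : Type*) (H K : ℕ) where
  explore : (k : Fin K) → (Fin k → Episode S A H) → ActingRule S A H
  plan : (Fin K → Episode S A H) → Reward S A H → PMF (Policy S A H)

/-- Law of the first `k` episodes collected by the algorithm. -/
def Algorithm.dataLaw (alg : Algorithm S A H K) (P : TransitionKernel S A) (s₁ : S) :
    (k : ℕ) → k ≤ K → PMF (Fin k → Episode S A H)
  | 0, _ => PMF.pure Fin.elim0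
  | k + 1, hk =>
      (alg.dataLaw P s₁ k (Nat.le_of_succ_le hk)).bind fun D =>
        (episodeLaw P s₁ (alg.explore ⟨k, hk⟩ D)).map fun e =>
          Fin.snoc (α := fun _ => Episode S A H) D e

/-- Law of the policy returned in the planning phase for the reward `r`. -/
def Algorithm.outputLaw (alg : Algorithm S A H K) (P : TransitionKernel S A) (s₁ : S)
    (r : Reward S A H) : PMF (Policy S A H) :=
  (alg.dataLaw P s₁ K le_rfl).bind fun D => alg.plan D r

/-- Probability that the returned policy `π` is `ε`-optimal, `V_1^*(s₁; r) - V_1^π(s₁; r) ≤ ε`. -/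
def Algorithm.successProb (alg : Algorithm S A H K) (P : TransitionKernel S A) (s₁ : S)
    (r : Reward S A H) (ε : ℝ) : ℝ :=
  ((alg.outputLaw P s₁ r).toOuterMeasure
    {π | optimalValue P s₁ r - value P s₁ r π ≤ ε}).toReal

/-! ### The hard-to-learn linear mixture MDPs -/

/-- The states `x₁, x₂, x₃` are `0, 1, 2`. -/
abbrev HardState := Fin 3

/-- The actions: sign vectors `{-1, 1}^{d-1}`. -/
abbrev HardAction (d : ℕ) := Fin (d - 1) → ℤˣ

/-- The gap `Δ = √(δ / K') / (4√2)` with `δ = 1/6`. -/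
def hardGap (K' : ℕ) : ℝ := √((1 / 6) / (K' : ℝ)) / (4 * √2)

/-- The scale `α = √(1 / (1 + (d-1)Δ))` of the first feature. -/
def hardAlpha (d : ℕ) (Δ : ℝ) : ℝ := √(1 / (1 + ((d - 1 : ℕ) : ℝ) * Δ))

/-- The scale `β = √(Δ / (1 + (d-1)Δ))` of the other features. -/
def hardBeta (d : ℕ) (Δ : ℝ) : ℝ := √(Δ / (1 + ((d - 1 : ℕ) : ℝ) * Δ))

/-- The vector `(x, vᵀ)ᵀ ∈ ℝᵈ` with `v ∈ ℝ^{d-1}`. -/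
def consVec (d : ℕ) (x : ℝ) (v : Fin (d - 1) → ℝ) : EuclideanSpace ℝ (Fin d) :=
  WithLp.toLp 2 fun i =>
    if h : (i : ℕ) = 0 then x else v ⟨i - 1, by omega⟩

/-- The features of the hard instances. -/
def hardFeature (d : ℕ) (Δ : ℝ) (s : HardState) (a : HardAction d) (s' : HardState) :
    EuclideanSpace ℝ (Fin d) :=
  if s = 0 ∧ s' = 1 then
    consVec d (hardAlpha d Δ * (1 - 1 / 6)) fun i => -(hardBeta d Δ * ((a i : ℤ) : ℝ))
  else if s = 0 ∧ s' = 2 then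
    consVec d (hardAlpha d Δ * (1 / 6)) fun i => hardBeta d Δ * ((a i : ℤ) : ℝ)
  else if s ≠ 0 ∧ s' = s then
    consVec d (hardAlpha d Δ) fun _ => 0
  else 0

/-- The parameter `θ = (1/α, μᵀ/β)ᵀ`, where `μ = Δσ ∈ {-Δ, Δ}^{d-1}`. With the features above,
`ℙ(x₃ | x₁, a) = 1/6 + ⟨μ, a⟩`, `ℙ(x₂ | x₁, a) = 1 - (1/6 + ⟨μ, a⟩)`, and `x₂`, `x₃` are
absorbing. -/
def hardParam (d : ℕ) (Δ : ℝ) (σ : Fin (d - 1) → ℤˣ) : EuclideanSpace ℝ (Fin d) :=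
  consVec d (1 / hardAlpha d Δ) fun i => Δ * ((σ i : ℤ) : ℝ) / hardBeta d Δ

/-- The reward: `1/H` in the state `x₃`, and `0` in `x₁` and `x₂`. -/
def hardReward (d H : ℕ) : Reward HardState (HardAction d) H :=
  fun _ s _ => if s = 2 then 1 / (H : ℝ) else 0

end

end RewardFreeRL

open RewardFreeRL

/-! An episode carries one bit about `σ`: the first transition, a Bernoulli variable with mean `1/6
+ Δ⟨σ, a⟩`. Afterwards the state is frozen and the kernels for all `σ` agree. Write `D = d - 1`.

Flipping one sign moves that mean by `2Δ`, so the affinity of the two transition laws is at least `1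
- 24Δ²`. Affinity is supermultiplicative under composition and does not decrease under common
randomisation, so `K` adaptively chosen episodes and the planning step leave affinity at least `(1 -
24Δ²)^K ≥ 1 - 24KΔ²` (`pow_le_affinity_outputLaw`). This is at least `3/4` once `96KΔ² ≤ 1`.

Assouad's argument (`exists_le_expect_signDist`), applied to the first action of the returned
policy, gives a `σ` with at least `D/8` wrong signs on average. Each wrong sign costs at least `Δ`
in value (`mul_signDist_le_optimalValue_sub_value`), so with `DΔ ≥ 16ε` an `ε`-optimal policy has at
most `D/16` wrong signs; success therefore has probability at most `14/15`. Choosing `K'` so that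
`DΔ` is of order `ε` turns the condition on `KΔ²` into `K` of order at most `d²/ε²`. -/

namespace RewardFreeRL

noncomputable section

open Finset

/-! ### Expectations and affinities of probability mass functions on finite types -/

section FinitePMF

variable {X Y : Type*} [Fintype X] [Fintype Y]

/-- The expectation of `g` under `p`. -/
def expect (p : PMF X) (g : X → ℝ) : ℝ := ∑ x, (p x).toReal * g x

theorem sum_toReal_eq_one (p : PMF X) : ∑ x, (p x).toReal = 1 := by
  rw [← ENNReal.toReal_sum fun x _ => p.apply_ne_top x, ← tsum_fintype (L := .unconditional X),
    p.tsum_coe, ENNReal.toReal_one]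

theorem expect_const (p : PMF X) (c : ℝ) : expect p (fun _ => c) = c := by
  rw [expect, ← Finset.sum_mul, sum_toReal_eq_one, one_mul]

theorem expect_add (p : PMF X) (f g : X → ℝ) :
    expect p (fun x => f x + g x) = expect p f + expect p g := by
  simp only [expect, mul_add, Finset.sum_add_distrib]

theorem expect_const_mul (p : PMF X) (c : ℝ) (g : X → ℝ) :
    expect p (fun x => c * g x) = c * expect p g := by
  simp only [expect, Finset.mul_sum]
  exact Finset.sum_congr rfl fun x _ => by ring

theorem expect_sum {ι : Type*} (s : Finset ι) (p : PMF X) (g : ι → X → ℝ) :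
    expect p (fun x => ∑ i ∈ s, g i x) = ∑ i ∈ s, expect p (g i) := by
  simp only [expect, Finset.mul_sum]
  exact Finset.sum_comm

theorem expect_mono (p : PMF X) {f g : X → ℝ} (h : ∀ x, f x ≤ g x) : expect p f ≤ expect p g :=
  Finset.sum_le_sum fun x _ => mul_le_mul_of_nonneg_left (h x) ENNReal.toReal_nonneg

theorem expect_congr_support (p : PMF X) {f g : X → ℝ} (h : ∀ x ∈ p.support, f x = g x) :
    expect p f = expect p g := by
  refine Finset.sum_congr rfl fun x _ => ?_
  by_cases hx : x ∈ p.support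
  · rw [h x hx]
  · rw [(p.apply_eq_zero_iff x).2 hx]; simp

theorem toReal_bind_apply {X Y : Type*} [Fintype X] (p : PMF X) (f : X → PMF Y) (y : Y) :
    (p.bind f y).toReal = ∑ x, (p x).toReal * (f x y).toReal := by
  rw [PMF.bind_apply, tsum_fintype, ENNReal.toReal_sum]
  · simp only [ENNReal.toReal_mul]
  · exact fun x _ => ENNReal.mul_ne_top (p.apply_ne_top x) ((f x).apply_ne_top y)

theorem expect_bind (p : PMF X) (f : X → PMF Y) (g : Y → ℝ) :
    expect (p.bind f) g = expect p fun x => expect (f x) g := by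
  simp only [expect, toReal_bind_apply, Finset.sum_mul, Finset.mul_sum]
  rw [Finset.sum_comm]
  exact Finset.sum_congr rfl fun x _ => Finset.sum_congr rfl fun y _ => by ring

theorem expect_pure (x : X) (g : X → ℝ) : expect (PMF.pure x) g = g x := by
  classical
  rw [expect, Finset.sum_eq_single x]
  · simp
  · intro y _ hy
    simp [hy]
  · simp

theorem expect_map (p : PMF X) (f : X → Y) (g : Y → ℝ) :
    expect (p.map f) g = expect p fun x => g (f x) := by
  rw [PMF.map, expect_bind]
  simp only [Function.comp_apply, expect_pure]

theorem toReal_toOuterMeasure (p : PMF X) (s : Set X) [DecidablePred (· ∈ s)] :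
    (p.toOuterMeasure s).toReal = expect p fun x => if x ∈ s then 1 else 0 := by
  rw [PMF.toOuterMeasure_apply_fintype, ENNReal.toReal_sum, expect]
  · refine Finset.sum_congr rfl fun x _ => ?_
    by_cases hx : x ∈ s <;> simp [hx]
  · intro x _
    by_cases hx : x ∈ s <;> simp [hx, p.apply_ne_top]

/-- The affinity (Bhattacharyya coefficient) of two probability mass functions. -/
def affinity (p q : PMF X) : ℝ := ∑ x, √(p x).toReal * √(q x).toReal

theorem affinity_self (p : PMF X) : affinity p p = 1 := by
  simp only [affinity, Real.mul_self_sqrt ENNReal.toReal_nonneg, sum_toReal_eq_one]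

theorem affinity_nonneg (p q : PMF X) : 0 ≤ affinity p q :=
  Finset.sum_nonneg fun _ _ => mul_nonneg (Real.sqrt_nonneg _) (Real.sqrt_nonneg _)

/-- The affinity of two compositions is at least the affinity of the first factors times a common
lower bound for the affinities of the second factors. -/
theorem mul_affinity_le_affinity_bind (p q : PMF X) (f g : X → PMF Y) {b : ℝ}
    (h : ∀ x ∈ p.support, b ≤ affinity (f x) (g x)) :
    b * affinity p q ≤ affinity (p.bind f) (q.bind g) := by
  calc b * affinity p q
      ≤ ∑ x, √(p x).toReal * √(q x).toReal * affinity (f x) (g x) := by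
        rw [affinity, Finset.mul_sum]
        refine Finset.sum_le_sum fun x _ => ?_
        by_cases hx : x ∈ p.support
        · rw [mul_comm]
          exact mul_le_mul_of_nonneg_left (h x hx) (by positivity)
        · rw [(p.apply_eq_zero_iff x).2 hx]; simp
    _ = ∑ y, ∑ x, √((p x).toReal * (f x y).toReal) * √((q x).toReal * (g x y).toReal) := by
        simp only [affinity, Finset.mul_sum]
        rw [Finset.sum_comm]
        refine Finset.sum_congr rfl fun y _ => Finset.sum_congr rfl fun x _ => ?_
        rw [Real.sqrt_mul ENNReal.toReal_nonneg, Real.sqrt_mul ENNReal.toReal_nonneg]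
        ring
    _ ≤ affinity (p.bind f) (q.bind g) := by
        refine Finset.sum_le_sum fun y _ => ?_
        rw [toReal_bind_apply, toReal_bind_apply]
        -- Cauchy–Schwarz over `x` for fixed `y`: forgetting the intermediate point can only raise
        -- the affinity.
        exact Real.sum_sqrt_mul_sqrt_le _ (fun x => by positivity) (fun x => by positivity)

/-- Data processing: randomising both laws by the same kernel cannot make them easier to tell apart.
-/
theorem mul_affinity_le_affinity_bind_left (p q : PMF X) (f : X → PMF Y) :
    affinity p q ≤ affinity (p.bind f) (q.bind f) := by
  have := mul_affinity_le_affinity_bind p q f f (b := 1) fun x _ => (affinity_self (f x)).ge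
  rwa [one_mul] at this

theorem affinity_le_affinity_map (p q : PMF X) (f : X → Y) :
    affinity p q ≤ affinity (p.map f) (q.map f) :=
  mul_affinity_le_affinity_bind_left p q _

/-- Every test between `p` and `q` has total error at least half the squared affinity. -/
theorem affinity_sq_div_two_le (p q : PMF X) (g : X → ℝ) (hg₀ : ∀ x, 0 ≤ g x)
    (hg₁ : ∀ x, g x ≤ 1) :
    affinity p q ^ 2 / 2 ≤ expect p g + expect q fun x => 1 - g x := by
  set m : X → ℝ := fun x => min (p x).toReal (q x).toReal
  set M : X → ℝ := fun x => max (p x).toReal (q x).toReal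
  have hm : ∀ x, 0 ≤ m x := fun x => le_min ENNReal.toReal_nonneg ENNReal.toReal_nonneg
  have hM : ∀ x, 0 ≤ M x := fun x => le_max_of_le_left ENNReal.toReal_nonneg
  -- Cauchy–Schwarz after writing `p q = min · max`. The sum of the minima bounds the error of any
  -- test from below, and the sum of the maxima is at most `2`.
  have h₁ : affinity p q ≤ √(∑ x, m x) * √(∑ x, M x) := by
    refine le_trans (le_of_eq ?_) (Real.sum_sqrt_mul_sqrt_le _ hm hM)
    refine Finset.sum_congr rfl fun x _ => ?_
    rw [← Real.sqrt_mul ENNReal.toReal_nonneg, ← Real.sqrt_mul (hm x), min_mul_max]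
  have h₂ : ∑ x, M x ≤ 2 := by
    calc ∑ x, M x ≤ ∑ x, ((p x).toReal + (q x).toReal) :=
          Finset.sum_le_sum fun x _ =>
            max_le_add_of_nonneg ENNReal.toReal_nonneg ENNReal.toReal_nonneg
      _ = 2 := by rw [Finset.sum_add_distrib, sum_toReal_eq_one, sum_toReal_eq_one]; norm_num
  have h₃ : ∑ x, m x ≤ expect p g + expect q fun x => 1 - g x := by
    rw [expect, expect, ← Finset.sum_add_distrib]
    refine Finset.sum_le_sum fun x _ => ?_
    have h₄ := mul_le_mul_of_nonneg_right (min_le_left (p x).toReal (q x).toReal) (hg₀ x)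
    have h₅ := mul_le_mul_of_nonneg_right (min_le_right (p x).toReal (q x).toReal)
      (sub_nonneg.2 (hg₁ x))
    simp only [m]
    linarith
  have h₆ : 0 ≤ ∑ x, m x := Finset.sum_nonneg fun x _ => hm x
  have h₇ : affinity p q ^ 2 ≤ (∑ x, m x) * ∑ x, M x := by
    calc affinity p q ^ 2 ≤ (√(∑ x, m x) * √(∑ x, M x)) ^ 2 :=
          pow_le_pow_left₀ (affinity_nonneg p q) h₁ 2
      _ = _ := by
          rw [mul_pow, Real.sq_sqrt h₆, Real.sq_sqrt (Finset.sum_nonneg fun x _ => hM x)]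
  nlinarith

end FinitePMF

/-- With `u = √x`, `v = √y`, the AM–GM defect is `(u - v)²/2`, while `(x - y)² = (u - v)²(u + v)²`
and `(u + v)² ≥ x + y ≥ 1/6`; hence the constant `3`. -/
theorem sqrt_mul_sqrt_ge {x y : ℝ} (hx : 1 / 12 ≤ x) (hy : 1 / 12 ≤ y) :
    (x + y) / 2 - 3 * (x - y) ^ 2 ≤ √x * √y := by
  have hu := Real.sq_sqrt (show 0 ≤ x by linarith)
  have hv := Real.sq_sqrt (show 0 ≤ y by linarith)
  have hu₀ := Real.sqrt_nonneg x
  have hv₀ := Real.sqrt_nonneg y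
  generalize √x = u at *
  generalize √y = v at *
  subst hu hv
  have h₁ : 1 / 6 ≤ (u + v) ^ 2 := by nlinarith [mul_nonneg hu₀ hv₀]
  nlinarith [mul_nonneg (sq_nonneg (u - v)) (sub_nonneg.2 h₁)]

/-! ### Three-state kernels with two absorbing states -/

section ThreeState

variable {A : Type*}

/-- Transition probabilities: from `0` to `2` with probability `q a` and to `1` otherwise; `1` and
`2` are absorbing. -/
def threeStateProb (q : A → ℝ) (s : Fin 3) (a : A) (s' : Fin 3) : ℝ :=
  if s = 0 then if s' = 2 then q a else if s' = 1 then 1 - q a else 0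
  else if s' = s then 1 else 0

theorem threeStateProb_nonneg {q : A → ℝ} (hq : ∀ a, q a ∈ Set.Icc (0 : ℝ) 1) (s : Fin 3) (a : A)
    (s' : Fin 3) : 0 ≤ threeStateProb q s a s' := by
  have h₁ := (hq a).1
  have h₂ := sub_nonneg.2 (hq a).2
  unfold threeStateProb
  split_ifs <;> first | assumption | norm_num

/-- The kernel with transition probabilities `threeStateProb q`. -/
def threeStateKernel (q : A → ℝ) (hq : ∀ a, q a ∈ Set.Icc (0 : ℝ) 1) :
    TransitionKernel (Fin 3) A := fun s a =>
  PMF.ofFintype (fun s' => ENNReal.ofReal (threeStateProb q s a s')) (by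
    rw [← ENNReal.ofReal_sum_of_nonneg fun s' _ => threeStateProb_nonneg hq s a s']
    fin_cases s <;> simp [Fin.sum_univ_three, threeStateProb])

variable {q : A → ℝ} {hq : ∀ a, q a ∈ Set.Icc (0 : ℝ) 1}

theorem toReal_threeStateKernel (s : Fin 3) (a : A) (s' : Fin 3) :
    (threeStateKernel q hq s a s').toReal = threeStateProb q s a s' := by
  simp only [threeStateKernel, PMF.ofFintype_apply]
  exact ENNReal.toReal_ofReal (threeStateProb_nonneg hq s a s')

theorem threeStateKernel_zero (s : Fin 3) (a : A) : threeStateKernel q hq s a 0 = 0 := by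
  simp only [threeStateKernel, PMF.ofFintype_apply]
  fin_cases s <;> simp [threeStateProb]

theorem threeStateKernel_congr {q' : A → ℝ} {hq' : ∀ a, q' a ∈ Set.Icc (0 : ℝ) 1} {s : Fin 3}
    (hs : s ≠ 0) (a : A) : threeStateKernel q hq s a = threeStateKernel q' hq' s a := by
  ext s'
  simp [threeStateKernel, PMF.ofFintype_apply, threeStateProb, hs]

theorem expect_threeStateKernel (s : Fin 3) (a : A) (hs : s ≠ 0) (g : Fin 3 → ℝ) :
    expect (threeStateKernel q hq s a) g = g s := by
  simp only [expect, toReal_threeStateKernel, threeStateProb, if_neg hs]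
  simp

theorem expect_threeStateKernel_zero (a : A) (g : Fin 3 → ℝ) :
    expect (threeStateKernel q hq 0 a) g = (1 - q a) * g 1 + q a * g 2 := by
  simp [expect, toReal_threeStateKernel, threeStateProb, Fin.sum_univ_three]

/-- The window is symmetric under `q ↦ 1 - q`, so the square-root bound applies to both outcomes;
each loses `3(q - q')²`. -/
theorem affinity_threeStateKernel_zero {q' : A → ℝ} {hq' : ∀ a, q' a ∈ Set.Icc (0 : ℝ) 1} (a : A)
    (h : q a ∈ Set.Icc (1 / 12 : ℝ) (11 / 12)) (h' : q' a ∈ Set.Icc (1 / 12 : ℝ) (11 / 12)) :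
    1 - 6 * (q a - q' a) ^ 2 ≤
      affinity (threeStateKernel q hq 0 a) (threeStateKernel q' hq' 0 a) := by
  have h₁ := sqrt_mul_sqrt_ge h.1 h'.1
  have h₂ := sqrt_mul_sqrt_ge (x := 1 - q a) (y := 1 - q' a) (by linarith [h.2])
    (by linarith [h'.2])
  have h₃ : affinity (threeStateKernel q hq 0 a) (threeStateKernel q' hq' 0 a) =
      √(1 - q a) * √(1 - q' a) + √(q a) * √(q' a) := by
    simp [affinity, toReal_threeStateKernel, threeStateProb, Fin.sum_univ_three]
  rw [h₃]
  nlinarith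

end ThreeState

/-! ### Affinity of the laws of episodes, data and outputs -/

section Laws

variable {A : Type*} {H K : ℕ}

/-- Every visited state after the first is the target of a transition, and no transition enters `0`.
Hence only the first transition can depend on the parameter. -/
theorem ne_zero_of_mem_support_historyLaw {P : TransitionKernel (Fin 3) A}
    (hP : ∀ s a, P s a 0 = 0) (ρ : ActingRule (Fin 3) A H) (h : ℕ) (hh : h + 1 ≤ H)
    {x : History (Fin 3) A (h + 1) × Fin 3} (hx : x ∈ (historyLaw P 0 ρ (h + 1) hh).support) :
    x.2 ≠ 0 := by
  simp only [historyLaw, PMF.mem_support_bind_iff, PMF.mem_support_map_iff] at hx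
  obtain ⟨y, -, a, -, s', hs', rfl⟩ := hx
  rintro h0
  simp only at h0
  subst h0
  exact (PMF.mem_support_iff _ _).1 hs' (hP _ _)

variable [Fintype A]

/-- The loss `b` is paid only at the first transition: later states are nonzero, where the kernels
agree, so every further stage contributes a factor `1`. The bound does not depend on the length of
the episode. -/
theorem le_affinity_historyLaw {P P' : TransitionKernel (Fin 3) A} (hP : ∀ s a, P s a 0 = 0)
    (hPP' : ∀ s a, s ≠ 0 → P s a = P' s a) {b : ℝ} (hb : b ≤ 1)
    (hb' : ∀ a, b ≤ affinity (P 0 a) (P' 0 a)) (ρ : ActingRule (Fin 3) A H) (h : ℕ) (hh : h ≤ H) :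
    b ≤ affinity (historyLaw P 0 ρ h hh) (historyLaw P' 0 ρ h hh) := by
  -- The action is drawn by the same rule under both kernels, so only the transition can lower the
  -- affinity.
  have step : ∀ (h : ℕ) (hh : h + 1 ≤ H) (c : ℝ),
      (∀ x ∈ (historyLaw P 0 ρ h (Nat.le_of_succ_le hh)).support, ∀ a,
        c ≤ affinity (P x.2 a) (P' x.2 a)) →
      c * affinity (historyLaw P 0 ρ h (Nat.le_of_succ_le hh))
          (historyLaw P' 0 ρ h (Nat.le_of_succ_le hh)) ≤
        affinity (historyLaw P 0 ρ (h + 1) hh) (historyLaw P' 0 ρ (h + 1) hh) := by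
    intro h hh c hc
    refine mul_affinity_le_affinity_bind _ _ _ _ fun x hx => ?_
    have := mul_affinity_le_affinity_bind (ρ ⟨h, hh⟩ x.1 x.2) (ρ ⟨h, hh⟩ x.1 x.2)
      (fun a => (P x.2 a).map fun s' =>
        ((Fin.snoc (α := fun _ => Fin 3 × A) x.1 (x.2, a) : History (Fin 3) A (h + 1)), s'))
      (fun a => (P' x.2 a).map fun s' =>
        ((Fin.snoc (α := fun _ => Fin 3 × A) x.1 (x.2, a) : History (Fin 3) A (h + 1)), s'))
      (b := c) fun a _ => (hc x hx a).trans (affinity_le_affinity_map _ _ _)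
    rwa [affinity_self, mul_one] at this
  induction h with
  | zero => simpa only [historyLaw, affinity_self] using hb
  | succ h ih =>
    cases h with
    | zero =>
      refine le_trans ?_ (step 0 hh b ?_)
      · simp only [historyLaw, affinity_self, mul_one, le_refl]
      · intro x hx a
        simp only [historyLaw, PMF.mem_support_pure_iff] at hx
        subst hx
        exact hb' a
    | succ h =>
      refine (ih (Nat.le_of_succ_le hh)).trans ((one_mul _).ge.trans (step (h + 1) hh 1 ?_))
      intro x hx a
      rw [hPP' _ _ (ne_zero_of_mem_support_historyLaw hP ρ h _ hx), affinity_self]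

/-- The one-episode bound is uniform over acting rules, and given the same past the algorithm uses
the same rule under both kernels; adaptivity therefore costs nothing. -/
theorem pow_le_affinity_dataLaw {P P' : TransitionKernel (Fin 3) A} (hP : ∀ s a, P s a 0 = 0)
    (hPP' : ∀ s a, s ≠ 0 → P s a = P' s a) {b : ℝ} (hb₀ : 0 ≤ b) (hb : b ≤ 1)
    (hb' : ∀ a, b ≤ affinity (P 0 a) (P' 0 a)) (alg : Algorithm (Fin 3) A H K) (k : ℕ)
    (hk : k ≤ K) : b ^ k ≤ affinity (alg.dataLaw P 0 k hk) (alg.dataLaw P' 0 k hk) := by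
  induction k with
  | zero => simp only [Algorithm.dataLaw, affinity_self, pow_zero, le_refl]
  | succ k ih =>
    rw [pow_succ']
    refine (mul_le_mul_of_nonneg_left (ih (Nat.le_of_succ_le hk)) hb₀).trans ?_
    exact mul_affinity_le_affinity_bind _ _ _ _ fun D _ =>
      (le_affinity_historyLaw hP hPP' hb hb' _ H le_rfl).trans (affinity_le_affinity_map _ _ _)

theorem pow_le_affinity_outputLaw {P P' : TransitionKernel (Fin 3) A} (hP : ∀ s a, P s a 0 = 0)
    (hPP' : ∀ s a, s ≠ 0 → P s a = P' s a) {b : ℝ} (hb₀ : 0 ≤ b) (hb : b ≤ 1)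
    (hb' : ∀ a, b ≤ affinity (P 0 a) (P' 0 a)) (alg : Algorithm (Fin 3) A H K)
    (r : Reward (Fin 3) A H) :
    b ^ K ≤ affinity (alg.outputLaw P 0 r) (alg.outputLaw P' 0 r) :=
  (pow_le_affinity_dataLaw hP hPP' hb₀ hb hb' alg K le_rfl).trans
    (mul_affinity_le_affinity_bind_left _ _ _)

end Laws

/-! ### Values in the hard instances -/

section Values

variable {d H : ℕ} {q : HardAction d → ℝ} {hq : ∀ a, q a ∈ Set.Icc (0 : ℝ) 1}

/-- The first transition decides whether the state is `2`, and absorption preserves this at all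
later times. -/
theorem expect_ite_historyLaw (π : Policy HardState (HardAction d) H) (hH : 0 < H) (h : ℕ)
    (hh : h + 1 ≤ H) (c : ℝ) :
    expect (historyLaw (threeStateKernel q hq) 0 π.toActingRule (h + 1) hh)
      (fun x => if x.2 = 2 then c else 0) = q (π ⟨0, hH⟩ 0) * c := by
  induction h with
  | zero =>
    simp [historyLaw, Policy.toActingRule, expect_map, expect_threeStateKernel_zero]
  | succ h ih =>
    rw [← ih (Nat.le_of_succ_le hh), historyLaw, expect_bind]
    refine expect_congr_support _ fun x hx => ?_
    have hx₀ := ne_zero_of_mem_support_historyLaw (threeStateKernel_zero) _ h _ hx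
    simp only [expect_bind, expect_map, Policy.toActingRule, expect_pure]
    exact expect_threeStateKernel _ _ hx₀ _

/-- Stage `0` is spent in state `0` and earns nothing, so `h + 1` stages give only `h` equal
contributions. This is the source of the factor `(H - 1)/H` in the value. -/
theorem expect_sum_ite_historyLaw (π : Policy HardState (HardAction d) H) (hH : 0 < H) (h : ℕ)
    (hh : h + 1 ≤ H) (c : ℝ) :
    expect (historyLaw (threeStateKernel q hq) 0 π.toActingRule (h + 1) hh)
      (fun x => ∑ j, if (x.1 j).1 = 2 then c else 0) = h * (q (π ⟨0, hH⟩ 0) * c) := by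
  have step : ∀ (h : ℕ) (hh : h + 1 ≤ H),
      expect (historyLaw (threeStateKernel q hq) 0 π.toActingRule (h + 1) hh)
          (fun x => ∑ j, if (x.1 j).1 = 2 then c else 0) =
        expect (historyLaw (threeStateKernel q hq) 0 π.toActingRule h (Nat.le_of_succ_le hh))
          (fun x => ∑ j, if (x.1 j).1 = 2 then c else 0) +
        expect (historyLaw (threeStateKernel q hq) 0 π.toActingRule h (Nat.le_of_succ_le hh))
          (fun x => if x.2 = 2 then c else 0) := by
    intro h hh
    rw [historyLaw, expect_bind, ← expect_add]
    congr 1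
    funext x
    simp only [expect_bind, expect_map, Policy.toActingRule, expect_const,
      Fin.sum_univ_castSucc, Fin.snoc_castSucc, Fin.snoc_last]
  induction h with
  | zero =>
    rw [step]
    simp [historyLaw, expect_pure]
  | succ h ih =>
    rw [step, ih (Nat.le_of_succ_le hh), expect_ite_historyLaw π hH h]
    push_cast
    ring

theorem value_threeStateKernel (π : Policy HardState (HardAction d) H) (hH : 0 < H) :
    value (threeStateKernel q hq) 0 (hardReward d H) π =
      ((H : ℝ) - 1) / H * q (π ⟨0, hH⟩ 0) := by
  obtain ⟨n, rfl⟩ : ∃ n, H = n + 1 := ⟨H - 1, by omega⟩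
  rw [value, tsum_fintype]
  refine (expect_sum_ite_historyLaw (hq := hq) π hH n le_rfl (1 / ((n + 1 : ℕ) : ℝ))).trans ?_
  push_cast
  ring

theorem hardReward_mem_boundedTotalRewards (hH : 0 < H) :
    hardReward d H ∈ boundedTotalRewards HardState (HardAction d) H := by
  have hH' : (0 : ℝ) < H := by exact_mod_cast hH
  have hH₁ : (1 : ℝ) ≤ H := by exact_mod_cast hH
  have h₀ : ∀ h s a, 0 ≤ hardReward d H h s a := by
    intro h s a
    unfold hardReward
    split_ifs <;> positivity
  have h₁ : ∀ h s a, hardReward d H h s a ≤ 1 / H := by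
    intro h s a
    unfold hardReward
    split_ifs
    · exact le_rfl
    · positivity
  refine ⟨fun h s a => ⟨h₀ h s a, (h₁ h s a).trans ?_⟩, fun τ => ⟨?_, ?_⟩⟩
  · rw [div_le_one hH']
    exact hH₁
  · exact Finset.sum_nonneg fun h _ => h₀ _ _ _
  · calc totalReward (hardReward d H) τ ≤ ∑ _h : Fin H, 1 / (H : ℝ) :=
          Finset.sum_le_sum fun h _ => h₁ _ _ _
      _ = 1 := by
          rw [Finset.sum_const, Finset.card_univ, Fintype.card_fin, nsmul_eq_mul]
          field_simp

end Values

/-! ### Sign vectors -/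

section Signs

variable {n : ℕ}

/-- The inner product of two sign vectors. -/
def signInner (σ a : Fin n → ℤˣ) : ℝ := ∑ i, ((σ i : ℤ) : ℝ) * ((a i : ℤ) : ℝ)

/-- The number of coordinates in which two sign vectors differ. -/
def signDist (σ a : Fin n → ℤˣ) : ℝ := ∑ i, if a i = σ i then 0 else 1

theorem sign_mul_sign (u v : ℤˣ) :
    ((u : ℤ) : ℝ) * ((v : ℤ) : ℝ) = 1 - 2 * if v = u then 0 else 1 := by
  rcases Int.units_eq_one_or u with rfl | rfl <;> rcases Int.units_eq_one_or v with rfl | rfl <;>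
    simp <;> norm_num

theorem signInner_eq (σ a : Fin n → ℤˣ) : signInner σ a = n - 2 * signDist σ a := by
  simp [signInner, signDist, sign_mul_sign, Finset.sum_sub_distrib, Finset.mul_sum]

theorem signDist_nonneg (σ a : Fin n → ℤˣ) : 0 ≤ signDist σ a :=
  Finset.sum_nonneg fun i _ => by split_ifs <;> norm_num

theorem signDist_le (σ a : Fin n → ℤˣ) : signDist σ a ≤ n := by
  calc signDist σ a ≤ ∑ _i : Fin n, (1 : ℝ) :=
        Finset.sum_le_sum fun i _ => by split_ifs <;> norm_num
    _ = n := by simp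

theorem abs_signInner_le (σ a : Fin n → ℤˣ) : |signInner σ a| ≤ n := by
  rw [signInner_eq, abs_le]
  constructor <;> linarith [signDist_nonneg σ a, signDist_le σ a]

/-- The sign vector `σ` with coordinate `i` flipped. -/
def flipSign (i : Fin n) : (Fin n → ℤˣ) ≃ (Fin n → ℤˣ) := Equiv.mulLeft (Pi.mulSingle i (-1))

theorem flipSign_same (i : Fin n) (σ : Fin n → ℤˣ) : flipSign i σ i = -σ i := by
  simp [flipSign]

theorem flipSign_of_ne {i j : Fin n} (h : j ≠ i) (σ : Fin n → ℤˣ) : flipSign i σ j = σ j := by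
  simp [flipSign, Pi.mulSingle_eq_of_ne h]

theorem signInner_sub_flipSign_sq (i : Fin n) (σ a : Fin n → ℤˣ) :
    (signInner σ a - signInner (flipSign i σ) a) ^ 2 = 4 := by
  rw [signInner, signInner, ← Finset.sum_sub_distrib, Finset.sum_eq_single i]
  · rw [flipSign_same]
    rcases Int.units_eq_one_or (σ i) with h | h <;> rcases Int.units_eq_one_or (a i) with h' | h' <;>
      simp [h, h'] <;> norm_num
  · intro j _ hj
    rw [flipSign_of_ne hj, sub_self]
  · simp

end Signs

/-- Assouad's lemma: if the laws of parameters that differ in one coordinate have affinity at least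
`3/4`, every estimator of the sign vector errs in an eighth of the coordinates on average, for
some parameter. -/
theorem exists_le_expect_signDist {n : ℕ} {X : Type*} [Fintype X] (p : (Fin n → ℤˣ) → PMF X)
    (f : X → Fin n → ℤˣ) (h : ∀ σ i, 3 / 4 ≤ affinity (p σ) (p (flipSign i σ))) :
    ∃ σ, (n : ℝ) / 8 ≤ expect (p σ) fun x => signDist σ (f x) := by
  set e : Fin n → (Fin n → ℤˣ) → ℝ := fun i σ =>
    expect (p σ) fun x => if f x i = σ i then 0 else 1
  -- The constant comes from `(3/4)²/2 = 9/32 ≥ 1/4`.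
  have h₁ : ∀ i σ, 1 / 4 ≤ e i σ + e i (flipSign i σ) := by
    intro i σ
    have h₂ := affinity_sq_div_two_le (p σ) (p (flipSign i σ))
      (fun x => if f x i = σ i then 0 else 1)
      (fun x => by split_ifs <;> norm_num) (fun x => by split_ifs <;> norm_num)
    -- A sign that is wrong for `σ i` is right for `-σ i`, so the two errors are the two error types
    -- of a single test.
    have h₃ : e i (flipSign i σ) =
        expect (p (flipSign i σ)) fun x => 1 - if f x i = σ i then 0 else 1 := by
      simp only [e, flipSign_same]
      congr 1
      funext x
      rcases Int.units_eq_one_or (σ i) with hs | hs <;>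
        rcases Int.units_eq_one_or (f x i) with hf | hf <;> simp [hs, hf]
    rw [← h₃] at h₂
    nlinarith [h σ i]
  have h₄ : ∀ i, ∑ _σ : Fin n → ℤˣ, (1 / 8 : ℝ) ≤ ∑ σ, e i σ := by
    intro i
    have h₅ : ∑ _σ : Fin n → ℤˣ, (1 / 4 : ℝ) ≤ ∑ σ, (e i σ + e i (flipSign i σ)) :=
      Finset.sum_le_sum fun σ _ => h₁ i σ
    -- Flipping is a bijection of the cube, so both halves of the sum are equal.
    rw [Finset.sum_add_distrib, Equiv.sum_comp (flipSign i) (e i)] at h₅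
    simp only [Finset.sum_const, nsmul_eq_mul] at h₅ ⊢
    linarith
  have h₆ : ∑ _σ : Fin n → ℤˣ, (n : ℝ) / 8 ≤
      ∑ σ, expect (p σ) fun x => signDist σ (f x) := by
    have h₇ : ∀ σ, (expect (p σ) fun x => signDist σ (f x)) = ∑ i, e i σ := fun σ =>
      expect_sum _ _ _
    simp only [h₇]
    rw [Finset.sum_comm]
    calc ∑ _σ : Fin n → ℤˣ, (n : ℝ) / 8 = ∑ _i : Fin n, ∑ _σ : Fin n → ℤˣ, (1 / 8 : ℝ) := by
          simp only [Finset.sum_const, nsmul_eq_mul, Finset.card_univ, Fintype.card_fin]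
          ring
      _ ≤ _ := Finset.sum_le_sum fun i _ => h₄ i
  obtain ⟨σ, -, hσ⟩ := Finset.exists_le_of_sum_le Finset.univ_nonempty h₆
  exact ⟨σ, hσ⟩

/-! ### The hard instances are linear mixture MDPs -/

section Mixture

variable {d : ℕ}

theorem sum_consVec_mul (hd : 1 ≤ d) (x y : ℝ) (v w : Fin (d - 1) → ℝ) :
    ∑ i, consVec d x v i * consVec d y w i = x * y + ∑ i, v i * w i := by
  obtain ⟨n, rfl⟩ : ∃ n, d = n + 1 := ⟨d - 1, by omega⟩
  rw [Fin.sum_univ_succ]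
  simp [consVec]

theorem norm_consVec_sq (hd : 1 ≤ d) (x : ℝ) (v : Fin (d - 1) → ℝ) :
    ‖consVec d x v‖ ^ 2 = x ^ 2 + ∑ i, v i ^ 2 := by
  rw [EuclideanSpace.real_norm_sq_eq]
  simpa only [sq] using sum_consVec_mul hd x x v v

theorem smul_consVec (c x : ℝ) (v : Fin (d - 1) → ℝ) :
    c • consVec d x v = consVec d (c * x) fun i => c * v i := by
  ext i
  simp only [consVec, PiLp.smul_apply, smul_eq_mul]
  split_ifs <;> rfl

theorem consVec_add (x y : ℝ) (v w : Fin (d - 1) → ℝ) :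
    consVec d x v + consVec d y w = consVec d (x + y) fun i => v i + w i := by
  ext i
  simp only [consVec, PiLp.add_apply]
  split_ifs <;> rfl

/-- The success probability `ℙ(x₃ | x₁, a)` of the hard instance with parameter `σ`. -/
def hardProb (d : ℕ) (Δ : ℝ) (σ a : Fin (d - 1) → ℤˣ) : ℝ := 1 / 6 + Δ * signInner σ a

theorem abs_mul_signInner_le {Δ : ℝ} (hΔ₀ : 0 ≤ Δ) (hΔ : ((d - 1 : ℕ) : ℝ) * Δ ≤ 1 / 12)
    (σ a : Fin (d - 1) → ℤˣ) : |Δ * signInner σ a| ≤ 1 / 12 := by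
  rw [abs_mul, abs_of_nonneg hΔ₀]
  nlinarith [mul_le_mul_of_nonneg_left (abs_signInner_le σ a) hΔ₀]

theorem hardProb_mem_Icc {Δ : ℝ} (hΔ₀ : 0 ≤ Δ) (hΔ : ((d - 1 : ℕ) : ℝ) * Δ ≤ 1 / 12)
    (σ a : Fin (d - 1) → ℤˣ) : hardProb d Δ σ a ∈ Set.Icc (1 / 12 : ℝ) (11 / 12) := by
  have := abs_le.1 (abs_mul_signInner_le hΔ₀ hΔ σ a)
  constructor <;> unfold hardProb <;> linarith [this.1, this.2]

theorem Icc_twelfths_subset : Set.Icc (1 / 12 : ℝ) (11 / 12) ⊆ Set.Icc 0 1 :=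
  Set.Icc_subset_Icc (by norm_num) (by norm_num)

theorem sum_sign_sq (a : Fin (d - 1) → ℤˣ) (c : ℝ) :
    ∑ i, (c * ((a i : ℤ) : ℝ)) ^ 2 = ((d - 1 : ℕ) : ℝ) * c ^ 2 := by
  have : ∀ i, (c * ((a i : ℤ) : ℝ)) ^ 2 = c ^ 2 := by
    intro i
    rcases Int.units_eq_one_or (a i) with h | h <;> simp [h]
  simp only [this, Finset.sum_const, nsmul_eq_mul, Finset.card_univ, Fintype.card_fin]

/-- The scales give `1/α² + DΔ²/β² = (1 + DΔ)²` with `D = d - 1`, so `‖θ‖ = 1 + DΔ ≤ B`. They also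
give `α² + Dβ² = 1`, so any vector `(xα, cβa)` with `|x|, |c| ≤ 1` has norm at most `1`; the sums of
features weighted by `V` have this form. -/
theorem isLinearMixture_hard (hd : 2 ≤ d) {Δ B : ℝ} (hΔ₀ : 0 < Δ)
    (hΔB : ((d - 1 : ℕ) : ℝ) * Δ ≤ B - 1) (σ : Fin (d - 1) → ℤˣ)
    (hq : ∀ a, hardProb d Δ σ a ∈ Set.Icc (0 : ℝ) 1) :
    IsLinearMixture (hardFeature d Δ) (hardParam d Δ σ) B
      (threeStateKernel (hardProb d Δ σ) hq) := by
  have hd₁ : 1 ≤ d := by omega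
  have hD : (0 : ℝ) ≤ ((d - 1 : ℕ) : ℝ) := Nat.cast_nonneg _
  have hden : 0 < 1 + ((d - 1 : ℕ) : ℝ) * Δ := by positivity
  have hα : 0 < hardAlpha d Δ := Real.sqrt_pos.2 (by positivity)
  have hβ : 0 < hardBeta d Δ := Real.sqrt_pos.2 (by positivity)
  have hα₂ : hardAlpha d Δ ^ 2 = 1 / (1 + ((d - 1 : ℕ) : ℝ) * Δ) := Real.sq_sqrt (by positivity)
  have hβ₂ : hardBeta d Δ ^ 2 = Δ / (1 + ((d - 1 : ℕ) : ℝ) * Δ) := Real.sq_sqrt (by positivity)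
  have hαβ : hardAlpha d Δ ^ 2 + ((d - 1 : ℕ) : ℝ) * hardBeta d Δ ^ 2 = 1 := by
    rw [hα₂, hβ₂]
    field_simp
  constructor
  · intro s a s'
    rw [toReal_threeStateKernel]
    have hin : ∑ i, hardBeta d Δ * ((a i : ℤ) : ℝ) * (Δ * ((σ i : ℤ) : ℝ) / hardBeta d Δ) =
        Δ * signInner σ a := by
      rw [signInner, Finset.mul_sum]
      refine Finset.sum_congr rfl fun i _ => ?_
      field_simp
    unfold hardFeature hardParam threeStateProb
    fin_cases s <;> fin_cases s' <;> simp (decide := true) only [if_true, if_false] <;>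
      simp [sum_consVec_mul hd₁, hin, hardProb, -mul_inv_rev, hα.ne'] <;>
      field_simp <;> ring
  · intro s a
    exact Summable.of_finite
  · have h₁ : ‖hardParam d Δ σ‖ ^ 2 = (1 + ((d - 1 : ℕ) : ℝ) * Δ) ^ 2 := by
      rw [hardParam, norm_consVec_sq hd₁]
      have : ∀ i, Δ * ((σ i : ℤ) : ℝ) / hardBeta d Δ = Δ / hardBeta d Δ * ((σ i : ℤ) : ℝ) :=
        fun i => by ring
      simp only [this]
      rw [sum_sign_sq, div_pow, div_pow, hα₂, hβ₂]
      field_simp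
    have h₂ := (pow_left_inj₀ (norm_nonneg _) hden.le two_ne_zero).1 h₁
    rw [h₂]
    linarith
  · intro V hV s a
    rw [tsum_fintype, Fin.sum_univ_three]
    have habs : ∀ s, 0 ≤ V s ∧ V s ≤ 1 := fun s => hV s
    have key : ∀ x c : ℝ, x ^ 2 ≤ 1 → c ^ 2 ≤ 1 →
        ‖consVec d (x * hardAlpha d Δ) fun i => (c * hardBeta d Δ) * ((a i : ℤ) : ℝ)‖ ≤ 1 := by
      intro x c hx hc
      have h₁ : ‖consVec d (x * hardAlpha d Δ)
          fun i => (c * hardBeta d Δ) * ((a i : ℤ) : ℝ)‖ ^ 2 ≤ 1 := by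
        rw [norm_consVec_sq hd₁, sum_sign_sq, mul_pow, mul_pow]
        have h₂ := mul_le_mul_of_nonneg_right hx (sq_nonneg (hardAlpha d Δ))
        have h₃ := mul_le_mul_of_nonneg_right hc
          (mul_nonneg hD (sq_nonneg (hardBeta d Δ)))
        linarith
      exact (sq_le_one_iff₀ (norm_nonneg _)).1 h₁
    have h₀ := habs 0
    have h₁ := habs 1
    have h₂ := habs 2
    have hfin : ∀ s : Fin 3, s = 0 ∨ s = 1 ∨ s = 2 := by decide
    rcases hfin s with rfl | rfl | rfl
    -- At `x₁` the first coefficient is a convex combination of values of `V` and the second is a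
    -- difference of two of them.
    · have h := key (V 1 * (1 - 1 / 6) + V 2 * (1 / 6)) (V 2 - V 1) (by nlinarith) (by nlinarith)
      refine le_of_eq_of_le ?_ h
      simp (decide := true) only [hardFeature, if_true, if_false, smul_zero, zero_add,
        smul_consVec, consVec_add]
      congr 2
      · ring
      · funext i
        ring
    · have h := key (V 1) 0 (by nlinarith) (by norm_num)
      refine le_of_eq_of_le ?_ h
      simp (decide := true) only [hardFeature, if_true, if_false, smul_zero, zero_add, add_zero,
        smul_consVec]
      congr 2
      funext i
      ring
    · have h := key (V 2) 0 (by nlinarith) (by norm_num)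
      refine le_of_eq_of_le ?_ h
      simp (decide := true) only [hardFeature, if_true, if_false, smul_zero, zero_add, add_zero,
        smul_consVec]
      congr 2
      funext i
      ring

end Mixture

/-! ### The lower bound -/

section LowerBound

variable {d H K : ℕ}

/-- The suboptimality of a policy is at least `Δ` times the number of wrong signs in its first
action. -/
theorem mul_signDist_le_optimalValue_sub_value (hH : 2 ≤ H) {Δ : ℝ} (hΔ₀ : 0 ≤ Δ)
    (σ : Fin (d - 1) → ℤˣ) (hq : ∀ a, hardProb d Δ σ a ∈ Set.Icc (0 : ℝ) 1)
    (π : Policy HardState (HardAction d) H) :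
    Δ * signDist σ (π ⟨0, by omega⟩ 0) ≤
      optimalValue (threeStateKernel (hardProb d Δ σ) hq) 0 (hardReward d H) -
        value (threeStateKernel (hardProb d Δ σ) hq) 0 (hardReward d H) π := by
  have hH₀ : 0 < H := by omega
  have h₁ : value (threeStateKernel (hardProb d Δ σ) hq) 0 (hardReward d H) (fun _ _ => σ) ≤
      optimalValue (threeStateKernel (hardProb d Δ σ) hq) 0 (hardReward d H) :=
    le_ciSup (Set.finite_range _).bddAbove _
  rw [value_threeStateKernel _ hH₀] at h₁ ⊢
  have h₂ : signInner σ σ = ((d - 1 : ℕ) : ℝ) := by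
    rw [signInner_eq]
    simp [signDist]
  -- `H ≥ 2` makes the reward factor at least `1/2`, which cancels the `2` lost in `⟨σ, a⟩` per
  -- wrong sign.
  have h₃ : (1 / 2 : ℝ) ≤ ((H : ℝ) - 1) / H := by
    have : (2 : ℝ) ≤ H := by exact_mod_cast hH
    rw [div_le_div_iff₀ (by norm_num) (by linarith)]
    linarith
  have h₄ := mul_nonneg hΔ₀ (signDist_nonneg σ (π ⟨0, hH₀⟩ 0))
  have h₅ : hardProb d Δ σ σ - hardProb d Δ σ (π ⟨0, hH₀⟩ 0) =
      2 * (Δ * signDist σ (π ⟨0, hH₀⟩ 0)) := by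
    rw [hardProb, hardProb, h₂, signInner_eq]
    ring
  have h₆ := mul_le_mul_of_nonneg_right h₃ (mul_nonneg zero_le_two h₄)
  rw [← h₅] at h₆
  linarith

/-- The returned policy's first action estimates `σ`, and success would make that estimate better
than Assouad's bound permits. The `1/12` keeps all Bernoulli means in the window where the affinity
bound holds. -/
theorem exists_successProb_le (hd : 2 ≤ d) (hH : 2 ≤ H) {Δ ε : ℝ} (hΔ₀ : 0 < Δ)
    (hΔ : ((d - 1 : ℕ) : ℝ) * Δ ≤ 1 / 12) (hε : 16 * ε ≤ ((d - 1 : ℕ) : ℝ) * Δ)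
    (alg : Algorithm HardState (HardAction d) H K) (hK : (K : ℝ) * (24 * Δ ^ 2) ≤ 1 / 4) :
    ∃ σ, alg.successProb (threeStateKernel (hardProb d Δ σ)
      fun a => Icc_twelfths_subset (hardProb_mem_Icc hΔ₀.le hΔ σ a)) 0 (hardReward d H) ε ≤
        14 / 15 := by
  classical
  have hD : (1 : ℝ) ≤ ((d - 1 : ℕ) : ℝ) := by
    have : 1 ≤ d - 1 := by omega
    exact_mod_cast this
  set P : (Fin (d - 1) → ℤˣ) → TransitionKernel HardState (HardAction d) := fun σ =>
    threeStateKernel (hardProb d Δ σ)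
      fun a => Icc_twelfths_subset (hardProb_mem_Icc hΔ₀.le hΔ σ a) with hP
  have hΔ₁ : 24 * Δ ^ 2 ≤ 1 := by
    have : Δ ≤ 1 / 12 := by nlinarith
    nlinarith
  have haff : ∀ σ i, 3 / 4 ≤ affinity (alg.outputLaw (P σ) 0 (hardReward d H))
      (alg.outputLaw (P (flipSign i σ)) 0 (hardReward d H)) := by
    intro σ i
    refine le_trans ?_ (pow_le_affinity_outputLaw (b := 1 - 24 * Δ ^ 2) threeStateKernel_zero
      (fun s a hs => threeStateKernel_congr hs a) (by linarith) (by nlinarith) ?_ alg _)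
    -- Bernoulli's inequality.
    · have := one_add_mul_le_pow (a := -(24 * Δ ^ 2)) (by linarith) K
      rw [← sub_eq_add_neg] at this
      linarith
    · intro a
      refine le_trans (le_of_eq ?_) (affinity_threeStateKernel_zero a
        (hardProb_mem_Icc hΔ₀.le hΔ σ a) (hardProb_mem_Icc hΔ₀.le hΔ _ a))
      have := signInner_sub_flipSign_sq i σ a
      have h₁ : hardProb d Δ σ a - hardProb d Δ (flipSign i σ) a =
          Δ * (signInner σ a - signInner (flipSign i σ) a) := by
        rw [hardProb, hardProb]
        ring
      rw [h₁, mul_pow, this]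
      ring
  obtain ⟨σ, hσ⟩ := exists_le_expect_signDist
    (fun σ => alg.outputLaw (P σ) 0 (hardReward d H))
    (fun π : Policy HardState (HardAction d) H => π ⟨0, by omega⟩ 0) haff
  refine ⟨σ, ?_⟩
  change alg.successProb (P σ) 0 (hardReward d H) ε ≤ 14 / 15
  rw [Algorithm.successProb, toReal_toOuterMeasure]
  simp only [Set.mem_ofPred_eq]
  set s := expect (alg.outputLaw (P σ) 0 (hardReward d H)) fun π =>
    if optimalValue (P σ) 0 (hardReward d H) - value (P σ) 0 (hardReward d H) π ≤ ε
      then (1 : ℝ) else 0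
  -- With `D = d - 1`, success leaves at most `ε/Δ ≤ D/16` wrong signs and failure at most `D`.
  -- Comparison with the lower bound `D/8` gives `s ≤ (7/8)(16/15) = 14/15`.
  have hle : (expect (alg.outputLaw (P σ) 0 (hardReward d H)) fun π =>
      signDist σ (π ⟨0, by omega⟩ 0)) ≤
      ((d - 1 : ℕ) : ℝ) + -(15 / 16 * ((d - 1 : ℕ) : ℝ)) * s := by
    rw [← expect_const (alg.outputLaw (P σ) 0 (hardReward d H)) ((d - 1 : ℕ) : ℝ),
      ← expect_const_mul, ← expect_add]
    refine expect_mono _ fun π => ?_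
    rw [expect_const]
    split_ifs with hπ
    · have h₁ := (mul_signDist_le_optimalValue_sub_value hH hΔ₀.le σ _ π).trans hπ
      have h₂ : Δ * signDist σ (π ⟨0, by omega⟩ 0) ≤ Δ * (((d - 1 : ℕ) : ℝ) / 16) := by linarith
      linarith [le_of_mul_le_mul_left h₂ hΔ₀]
    · linarith [signDist_le σ (π ⟨0, by omega⟩ 0)]
  have h₃ := hσ.trans hle
  nlinarith

theorem hardGap_pos {K' : ℕ} (hK' : 0 < K') : 0 < hardGap K' := by
  have : (0 : ℝ) < K' := by exact_mod_cast hK'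
  unfold hardGap
  positivity

theorem hardGap_sq (K' : ℕ) : hardGap K' ^ 2 = 1 / (192 * K') := by
  have : (0 : ℝ) ≤ K' := Nat.cast_nonneg _
  rw [hardGap, div_pow, Real.sq_sqrt (by positivity), mul_pow, Real.sq_sqrt (by norm_num),
    div_div, div_div]
  congr 1
  ring

/-- Some gap of the form `hardGap K'` is of order `t / x`. -/
theorem exists_hardGap {x t : ℝ} (hx : 1 ≤ x) (ht : 0 < t) (ht' : 192 * t ^ 2 ≤ 1) :
    ∃ K' : ℕ, 0 < K' ∧ t ^ 2 ≤ (x * hardGap K') ^ 2 ∧ (x * hardGap K') ^ 2 ≤ 2 * t ^ 2 := by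
  -- A real `K' = y` would give `x Δ = t` exactly, as `Δ² = 1/(192 K')`. Since `y ≥ 1`, rounding
  -- down at most halves it, which costs the factor `2`.
  set y := x ^ 2 / (192 * t ^ 2) with hy
  have hy₁ : 1 ≤ y := by
    rw [hy, le_div_iff₀ (by positivity)]
    nlinarith
  have hxy : x ^ 2 = 192 * t ^ 2 * y := by
    rw [hy]
    field_simp
  have hfl : 1 ≤ ⌊y⌋₊ := Nat.le_floor (by exact_mod_cast hy₁)
  have hfl' : (1 : ℝ) ≤ ⌊y⌋₊ := by exact_mod_cast hfl
  have h₁ : (⌊y⌋₊ : ℝ) ≤ y := Nat.floor_le (by linarith)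
  have h₂ : y < ⌊y⌋₊ + 1 := Nat.lt_floor_add_one y
  refine ⟨⌊y⌋₊, hfl, ?_, ?_⟩
  · rw [mul_pow, hardGap_sq, hxy, mul_one_div, le_div_iff₀ (by positivity)]
    nlinarith [mul_le_mul_of_nonneg_left h₁ (sq_nonneg t)]
  · rw [mul_pow, hardGap_sq, hxy, mul_one_div, div_le_iff₀ (by positivity)]
    have h₃ : y ≤ 2 * ⌊y⌋₊ := by linarith
    nlinarith [mul_le_mul_of_nonneg_left h₃ (sq_nonneg t)]

end LowerBound

end

end RewardFreeRL

open RewardFreeRL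
theorem theorem2 :
    ∃ C : ℝ, 0 < C ∧ ∃ c : ℝ, 0 < c ∧ ∃ δ₀ : ℝ, 0 < δ₀ ∧
      ∀ B : ℝ, 1 < B → ∀ d H : ℕ, 2 ≤ d → 2 ≤ H →
      ∀ ε : ℝ, 0 < ε → ε ≤ c * min 1 (B - 1) →
      ∃ K' : ℕ, 0 < K' ∧
        ∀ δ : ℝ, 0 < δ → δ ≤ δ₀ →
        ∀ (K : ℕ) (alg : Algorithm HardState (HardAction d) H K),
          (K : ℝ) < C * (d : ℝ) ^ 2 / ε ^ 2 →
          ∃ (σ : Fin (d - 1) → ℤˣ) (P : TransitionKernel HardState (HardAction d)),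
            IsLinearMixture (hardFeature d (hardGap K')) (hardParam d (hardGap K') σ) B P ∧
            hardReward d H ∈ boundedTotalRewards HardState (HardAction d) H ∧
            alg.successProb P 0 (hardReward d H) ε < 1 - δ := by
  -- With `DΔ ≤ 25ε`, `c = 1/300` gives both `DΔ ≤ 1/12` and `DΔ ≤ B - 1`. For `C`: `d ≤ 2D` and
  -- `(DΔ)² ≤ 2(16ε)²` require `24 · 512 · 4 · C ≤ 1/4`. For `δ₀`: `14/15 < 19/20`.
  refine ⟨1 / 200000, by norm_num, 1 / 300, by norm_num, 1 / 20, by norm_num, ?_⟩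
  intro B hB d H hd hH ε hε₀ hε
  have hε₁ : ε ≤ 1 / 300 := by linarith [min_le_left 1 (B - 1)]
  have hε₂ : ε ≤ 1 / 300 * (B - 1) := by linarith [min_le_right 1 (B - 1)]
  have hD₁ : (1 : ℝ) ≤ ((d - 1 : ℕ) : ℝ) := by
    have : 1 ≤ d - 1 := by omega
    exact_mod_cast this
  have hdD : (d : ℝ) ≤ 2 * ((d - 1 : ℕ) : ℝ) := by
    have : d ≤ 2 * (d - 1) := by omega
    exact_mod_cast this
  obtain ⟨K', hK'₀, hlow, hup⟩ := exists_hardGap (t := 16 * ε) hD₁ (by positivity) (by nlinarith)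
  refine ⟨K', hK'₀, fun δ hδ₀ hδ K alg hK => ?_⟩
  have hΔ₀ := hardGap_pos hK'₀
  have hDΔ : 0 ≤ ((d - 1 : ℕ) : ℝ) * hardGap K' := by positivity
  have hlow' : 16 * ε ≤ ((d - 1 : ℕ) : ℝ) * hardGap K' :=
    (pow_le_pow_iff_left₀ (by positivity) hDΔ two_ne_zero).1 hlow
  -- `2 · 16² = 512 ≤ 25²`.
  have hup' : ((d - 1 : ℕ) : ℝ) * hardGap K' ≤ 25 * ε :=
    (pow_le_pow_iff_left₀ hDΔ (by positivity) two_ne_zero).1 (by nlinarith)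
  have hKΔ : (K : ℝ) * (24 * hardGap K' ^ 2) ≤ 1 / 4 := by
    have hD₀ : (0 : ℝ) < ((d - 1 : ℕ) : ℝ) ^ 2 := by positivity
    have h₁ : (K : ℝ) * ε ^ 2 ≤ 1 / 50000 * ((d - 1 : ℕ) : ℝ) ^ 2 := by
      rw [lt_div_iff₀ (by positivity)] at hK
      nlinarith [pow_le_pow_left₀ (Nat.cast_nonneg d) hdD 2]
    have h₂ : (K : ℝ) * (((d - 1 : ℕ) : ℝ) * hardGap K') ^ 2 ≤ K * (2 * (16 * ε) ^ 2) :=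
      mul_le_mul_of_nonneg_left hup (Nat.cast_nonneg K)
    have h₃ : ((d - 1 : ℕ) : ℝ) ^ 2 * ((K : ℝ) * (24 * hardGap K' ^ 2)) ≤
        ((d - 1 : ℕ) : ℝ) ^ 2 * (1 / 4) := by
      nlinarith
    exact le_of_mul_le_mul_left h₃ hD₀
  obtain ⟨σ, hσ⟩ := exists_successProb_le hd hH hΔ₀ (by linarith) hlow' alg hKΔ
  exact ⟨σ, _, isLinearMixture_hard hd hΔ₀ (by linarith) σ _,
    hardReward_mem_boundedTotalRewards (by omega), by linarith⟩
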